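/- For $n\ge 1$ let $M_n\in\{0,1\}^{n\times n}$ be the prefix-sum matrix, $(M_n)_{ij}=1$ if $i\ge j$ and $0$ otherwise, and let $C=C_n$ be a real square root of it, $C^2=M_n$ (it is unique up to sign, and the sign does not matter below). Let $D=\operatorname{diag}(\|C_{:,1}\|_2,\dots,\|C_{:,n}\|_2)$ be the diagonal matrix of the column norms of $C$. The Normalized Square Root factorization is $M_n=\widetilde B\widetilde C$ with $\widetilde C=CD^{-1}$ and $\widetilde B=M_n\widetilde C^{-1}$. For a factorization $M_n=LR$, let $\Delta$ be the supremum of $\|Rx-Rx'\|_2$ over all $x,x'\in\mathbb R^n$ that differ in at most one coordinate, and there by at most $1$, and let $$\mathrm{MaxSE}(L,R)=\sup_{x\in\mathbb R^n}\max_{i}\Big(\mathbb E\big[\big(L(Rx+z)-M_nx\big)_i^2\big]\Big)^{1/2},\qquad z\sim\mathcal N(0,\Delta^2 I),$$ be the maximum squared error of the matrix mechanism $x\mapsto L(Rx+z)$ with the noise scale of the $1$-Gaussian differentially private Gaussian mechanism (it equals the largest row norm of $L$ times the largest column norm of $R$). Let $\alpha_n=\sum_{j=0}^{n-1}r_j^2-\frac{\log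 n}{\pi}$ with $r_j=4^{-j}\binom{2j}{j}$. Then the limit $\alpha_\infty=\lim_{n\to\infty}\alpha_n$ exists, and as $n\to\infty$ $$\mathrm{MaxSE}(\widetilde B,\widetilde C)=\alpha_\infty-\frac{\log 2}{\pi}+\frac{\log n}{\pi}+o(1)\;\le\;0.846+\frac{\log n}{\pi}+o(1).$$ -/

import Mathlib

open Filter Topology Asymptotics MeasureTheory ProbabilityTheory
open scoped Matrix

noncomputable section

namespace NSR

/-- The prefix-sum (counting) matrix: entry `(i, j)` is `1` if `j ≤ i` and `0` otherwise. -/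
def Mcount (n : ℕ) : Matrix (Fin n) (Fin n) ℝ :=
  Matrix.of fun i j => if j ≤ i then 1 else 0

/-! ### The matrix mechanism and its maximum squared error -/

/-- Neighboring input streams: they differ in at most one coordinate, and there by at most `1`. -/
def Neighboring {n : ℕ} (x x' : Fin n → ℝ) : Prop :=
  ∃ i, (∀ j, j ≠ i → x j = x' j) ∧ |x i - x' i| ≤ 1

/-- The `ℓ₂`-sensitivity of a query: the supremum of `‖f x - f x'‖₂` over neighboring inputs. -/
def l2Sensitivity {n m : ℕ} (f : (Fin n → ℝ) → (Fin m → ℝ)) : ℝ :=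
  sSup {s : ℝ | ∃ x x', Neighboring x x' ∧ s = ‖WithLp.toLp 2 (f x - f x')‖}

/-- The noise of the Gaussian mechanism that is `1`-Gaussian differentially private:
`m` independent centered Gaussians of standard deviation `σ`, the sensitivity. -/
def gaussianNoise (m : ℕ) (σ : ℝ) : Measure (Fin m → ℝ) :=
  Measure.pi fun _ => gaussianReal 0 (σ ^ 2).toNNReal

/-- The output law of the matrix mechanism `x ↦ L (R x + z)` for the factors `L`, `R`, where the
noise `z` is scaled to the sensitivity of `x ↦ R x`. -/
def matrixMechanism {n m : ℕ} (L : Matrix (Fin n) (Fin m) ℝ) (R : Matrix (Fin m) (Fin n) ℝ)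
    (x : Fin n → ℝ) : Measure (Fin n → ℝ) :=
  (gaussianNoise m (l2Sensitivity fun y => R *ᵥ y)).map fun z => L *ᵥ (R *ᵥ x + z)

/-- The worst-case root expected squared error, over the inputs and the coordinates, of a
mechanism (given by its output laws) that estimates all prefix sums. -/
def errInfty {n : ℕ} (mech : (Fin n → ℝ) → Measure (Fin n → ℝ)) : ℝ :=
  ⨆ x : Fin n → ℝ, ⨆ i : Fin n, √(∫ y, (y i - (Mcount n *ᵥ x) i) ^ 2 ∂(mech x))

/-- The maximum squared error of the factorization `L * R` of the prefix-sum matrix. -/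
def maxSE {n m : ℕ} (L : Matrix (Fin n) (Fin m) ℝ) (R : Matrix (Fin m) (Fin n) ℝ) : ℝ :=
  errInfty (matrixMechanism L R)

/-! ### The normalized square root factorization -/

/-- The Euclidean norm of the `j`-th column. -/
def colNorm {m n : ℕ} (A : Matrix (Fin m) (Fin n) ℝ) (j : Fin n) : ℝ :=
  ‖WithLp.toLp 2 (fun i => A i j)‖

/-- The Euclidean norm of the `i`-th row. -/
def rowNorm {m n : ℕ} (A : Matrix (Fin m) (Fin n) ℝ) (i : Fin m) : ℝ :=
  ‖WithLp.toLp 2 (fun j => A i j)‖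

/-- The diagonal matrix `D` of the column norms of `C`. -/
def nsrD {n : ℕ} (C : Matrix (Fin n) (Fin n) ℝ) : Matrix (Fin n) (Fin n) ℝ :=
  Matrix.diagonal (colNorm C)

/-- The right factor `C D⁻¹`. -/
def nsrRight {n : ℕ} (C : Matrix (Fin n) (Fin n) ℝ) : Matrix (Fin n) (Fin n) ℝ :=
  C * (nsrD C)⁻¹

/-- The left factor: the prefix-sum matrix times the inverse of the right factor. -/
def nsrLeft {n : ℕ} (C : Matrix (Fin n) (Fin n) ℝ) : Matrix (Fin n) (Fin n) ℝ :=
  Mcount n * (nsrRight C)⁻¹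

/-- `r k = binom(2k, k) / 4 ^ k`, the Taylor coefficients of `(1 - x) ^ (-1/2)`. -/
def r (k : ℕ) : ℝ := (Nat.centralBinom k : ℝ) / 4 ^ k

/-- `α n = ∑_{j < n} (r j)² - log n / π`. -/
def alpha (n : ℕ) : ℝ := ∑ j ∈ Finset.range n, r j ^ 2 - Real.log n / Real.pi

/-! ### The notions above are not vacuous -/

/-- The prefix-sum matrix has a real square root. -/
theorem exists_sqrt_Mcount (n : ℕ) :
    ∃ C : Matrix (Fin n) (Fin n) ℝ, C * C = Mcount n := by
  set c : PowerSeries ℝ :=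
    PowerSeries.rescale (-1 : ℝ) (PowerSeries.binomialSeries ℝ (-1 / 2 : ℝ)) with hc
  have hcc : c * c = PowerSeries.mk 1 := by
    have h1 : PowerSeries.binomialSeries ℝ (-1 / 2 : ℝ) * PowerSeries.binomialSeries ℝ (-1 / 2 : ℝ)
        = PowerSeries.binomialSeries ℝ (-1 : ℝ) := by
      rw [← PowerSeries.binomialSeries_add]; norm_num
    rw [hc, ← map_mul, h1]
    ext k
    simp [PowerSeries.coeff_rescale, PowerSeries.binomialSeries_coeff, Ring.choose_neg]
    rw [Ring.choose_natCast, Nat.choose_self, Int.negOnePow_def]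
    simp only [zpow_natCast, Units.smul_def]
    simp [← mul_pow]
  refine ⟨Matrix.of fun i j => if j ≤ i then PowerSeries.coeff ((i : ℕ) - j) c else 0, ?_⟩
  ext i j
  rw [Matrix.mul_apply]
  simp only [Matrix.of_apply, Mcount]
  have h0 : ∀ k : ℕ, PowerSeries.coeff k (c * c) = 1 := fun k => by rw [hcc]; simp
  split_ifs with hij
  · rw [← h0 ((i : ℕ) - j), PowerSeries.coeff_mul]
    symm
    have hsub : ∑ k : Fin n, ((if k ≤ i then PowerSeries.coeff ((i : ℕ) - k) c else 0) *
        if j ≤ k then PowerSeries.coeff ((k : ℕ) - j) c else 0)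
        = ∑ k ∈ Finset.univ.filter (fun k : Fin n => j ≤ k ∧ k ≤ i),
          PowerSeries.coeff ((i : ℕ) - k) c * PowerSeries.coeff ((k : ℕ) - j) c := by
      rw [Finset.sum_filter]
      refine Finset.sum_congr rfl fun k _ => ?_
      by_cases h1 : k ≤ i <;> by_cases h2 : j ≤ k <;> simp [h1, h2]
    rw [hsub]
    refine Finset.sum_bij' (fun p hp => ⟨(j : ℕ) + p.2, ?_⟩)
      (fun k _ => ((i : ℕ) - k, (k : ℕ) - j)) ?_ ?_ ?_ ?_ ?_
    · have := Finset.HasAntidiagonal.mem_antidiagonal.mp hp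
      have := i.2
      have : (j : ℕ) ≤ i := hij
      omega
    · intro p hp
      have := Finset.HasAntidiagonal.mem_antidiagonal.mp hp
      have : (j : ℕ) ≤ i := hij
      simp only [Finset.mem_filter, Finset.mem_univ, true_and, Fin.le_def]
      omega
    · intro k hk
      simp only [Finset.mem_filter, Finset.mem_univ, true_and, Fin.le_def] at hk
      simp only [Finset.HasAntidiagonal.mem_antidiagonal]
      omega
    · intro p hp
      have := Finset.HasAntidiagonal.mem_antidiagonal.mp hp
      have : (j : ℕ) ≤ i := hij
      ext <;> simp <;> omega
    · intro k hk
      simp only [Finset.mem_filter, Finset.mem_univ, true_and, Fin.le_def] at hk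
      ext
      simp
      omega
    · intro p hp
      have := Finset.HasAntidiagonal.mem_antidiagonal.mp hp
      have : (j : ℕ) ≤ i := hij
      have e1 : (i : ℕ) - (j + p.2) = p.1 := by omega
      have e2 : (j : ℕ) + p.2 - j = p.2 := by omega
      simp only [e1, e2]
  · refine Finset.sum_eq_zero fun k _ => ?_
    by_cases h1 : k ≤ i
    · have h2 : ¬ j ≤ k := fun h2 => hij (h2.trans h1)
      simp [h2]
    · simp [h1]

theorem det_Mcount (n : ℕ) : (Mcount n).det = 1 := by
  rw [Matrix.det_of_isLowerTriangular]
  · simp [Mcount]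
  · intro i j hij
    have h : i < j := hij
    simp [Mcount, not_le.mpr h]

theorem det_nsrRight_ne_zero {n : ℕ} {C : Matrix (Fin n) (Fin n) ℝ} (hC : C * C = Mcount n) :
    (nsrRight C).det ≠ 0 := by
  have hd : C.det ≠ 0 := by
    intro h
    have := congrArg Matrix.det hC
    rw [Matrix.det_mul, det_Mcount, h] at this
    simp at this
  have hcol : ∀ j, colNorm C j ≠ 0 := by
    intro j h
    apply hd
    apply Matrix.det_eq_zero_of_column_eq_zero j
    intro i
    have h2 := norm_eq_zero.mp h
    exact congrFun (congrArg WithLp.ofLp h2) i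
  have hD : (nsrD C).det ≠ 0 := by
    rw [nsrD, Matrix.det_diagonal]
    exact Finset.prod_ne_zero_iff.mpr fun j _ => hcol j
  rw [nsrRight, Matrix.det_mul, Matrix.det_nonsing_inv]
  exact mul_ne_zero hd (by simpa using hD)

/-- The two factors do factor the prefix-sum matrix. -/
theorem nsrLeft_mul_nsrRight {n : ℕ} {C : Matrix (Fin n) (Fin n) ℝ} (hC : C * C = Mcount n) :
    nsrLeft C * nsrRight C = Mcount n := by
  rw [nsrLeft, Matrix.mul_assoc, Matrix.nonsing_inv_mul, Matrix.mul_one]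
  exact (det_nsrRight_ne_zero hC).isUnit

theorem l2Sensitivity_mulVec {n m : ℕ} (R : Matrix (Fin m) (Fin n) ℝ) :
    l2Sensitivity (fun y => R *ᵥ y) = ⨆ j, colNorm R j := by
  have hmem : ∀ j, colNorm R j ∈
      {s : ℝ | ∃ x x', Neighboring x x' ∧ s = ‖WithLp.toLp 2 (R *ᵥ x - R *ᵥ x')‖} := by
    intro j
    refine ⟨Pi.single j 1, 0, ⟨j, fun k hk => by simp [hk], by simp⟩, ?_⟩
    simp [colNorm]
    rfl
  have hle : ∀ s ∈ {s : ℝ | ∃ x x', Neighboring x x' ∧ s = ‖WithLp.toLp 2 (R *ᵥ x - R *ᵥ x')‖},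
      s ≤ ⨆ j, colNorm R j := by
    rintro s ⟨x, x', ⟨i, hi, h1⟩, rfl⟩
    have hx : x - x' = (x i - x' i) • Pi.single i (1 : ℝ) := by
      ext k
      by_cases hk : k = i
      · subst hk; simp
      · simp [hk, hi k hk]
    have h2 : WithLp.toLp 2 (R *ᵥ x - R *ᵥ x') =
        (x i - x' i) • WithLp.toLp 2 (fun k => R k i) := by
      rw [← Matrix.mulVec_sub, hx, Matrix.mulVec_smul, Matrix.mulVec_single_one]
      rfl
    rw [h2, norm_smul]
    calc ‖x i - x' i‖ * ‖WithLp.toLp 2 (fun k => R k i)‖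
        ≤ 1 * colNorm R i := mul_le_mul_of_nonneg_right h1 (norm_nonneg _)
      _ = colNorm R i := one_mul _
      _ ≤ _ := le_ciSup (Set.finite_range _).bddAbove i
  rcases isEmpty_or_nonempty (Fin n) with hn | hn
  · rw [Real.iSup_of_isEmpty, l2Sensitivity]
    convert Real.sSup_empty
    ext s
    simp only [Set.mem_ofPred_eq, Set.mem_empty_iff_false, iff_false]
    rintro ⟨x, x', ⟨i, _⟩, _⟩
    exact hn.elim i
  · apply le_antisymm
    · exact csSup_le ⟨_, hmem hn.some⟩ hle
    · exact ciSup_le fun j => le_csSup ⟨_, hle⟩ (hmem j)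

/-- For a factorization of the prefix-sum matrix, the maximum squared error is the largest row
norm of the left factor times the largest column norm of the right factor. -/
theorem maxSE_eq {n m : ℕ} {L : Matrix (Fin n) (Fin m) ℝ} {R : Matrix (Fin m) (Fin n) ℝ}
    (h : L * R = Mcount n) : maxSE L R = (⨆ i, rowNorm L i) * ⨆ j, colNorm R j := by
  have hσ : 0 ≤ ⨆ j, colNorm R j := Real.iSup_nonneg fun j => norm_nonneg _
  set σ := ⨆ j, colNorm R j with hσdef
  have key : ∀ x i, √(∫ y, (y i - (Mcount n *ᵥ x) i) ^ 2 ∂(matrixMechanism L R x))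
      = rowNorm L i * σ := by
    intro x i
    rw [matrixMechanism, l2Sensitivity_mulVec, ← hσdef, integral_map]
    · have hlin : ∀ z, (L *ᵥ (R *ᵥ x + z)) i - (Mcount n *ᵥ x) i = ∑ k, L i k * z k := by
        intro z
        rw [← h, Matrix.mulVec_add, Matrix.mulVec_mulVec, Pi.add_apply, add_sub_cancel_left]
        rfl
      simp_rw [hlin]
      have hmem : ∀ k, MemLp (fun t : ℝ => L i k * t) 2 (gaussianReal 0 (σ ^ 2).toNNReal) :=
        fun k => (memLp_id_gaussianReal' 2 (by simp)).const_mul _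
      have hv := variance_sum_pi hmem
      have hsum : (∑ k, fun z : Fin m → ℝ => L i k * z k) = fun z => ∑ k, L i k * z k := by
        ext z; simp
      have hvar : ∀ k, Var[fun t : ℝ => L i k * t; gaussianReal 0 (σ ^ 2).toNNReal]
          = L i k ^ 2 * σ ^ 2 := fun k => by
        rw [variance_const_mul, variance_fun_id_gaussianReal, Real.coe_toNNReal _ (sq_nonneg σ)]
      rw [hsum, variance_of_integral_eq_zero, Finset.sum_congr rfl fun k _ => hvar k] at hv
      · rw [gaussianNoise, hv]
        rw [← Finset.sum_mul, Real.sqrt_mul' _ (sq_nonneg σ),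
          Real.sqrt_sq hσ, rowNorm, EuclideanSpace.norm_eq]
        simp
      · exact (Measurable.aemeasurable (by fun_prop))
      · rw [integral_finsetSum]
        · refine Finset.sum_eq_zero fun k _ => ?_
          have h2 := integral_comp_eval (μ := fun _ : Fin m => gaussianReal 0 (σ ^ 2).toNNReal)
            (i := k) (f := fun t : ℝ => L i k * t) (by fun_prop)
          rw [h2, integral_const_mul]
          simp
        · intro k _
          exact integrable_comp_eval (μ := fun _ : Fin m => gaussianReal 0 (σ ^ 2).toNNReal)
            (i := k) (f := fun t : ℝ => L i k * t) ((hmem k).integrable (by simp))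
    · fun_prop
    · exact (Measurable.aestronglyMeasurable (by fun_prop))
  simp only [maxSE, errInfty, key]
  rw [ciSup_const, Real.iSup_mul_of_nonneg hσ]

end NSR

end

/-!
Let `T` be the lower triangular Toeplitz matrix of the coefficients `r` of `(1 - x) ^ (-1/2)`. A
square root `C` of the prefix-sum matrix commutes with it, hence with the shift, so it is Toeplitz
itself, and comparing power series gives `C = ± T` (`eq_lowerToeplitz_of_mul_self_eq`). The column
norms of `C` are therefore `√(G (n - j))` with `G n = ∑_{j < n} (r j)²`, which is
`log n / π + alphaInf + o(1)`. The columns of the right factor have norm `1`, and the error is the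
largest row norm of the left factor (`maxSE_nsr`). In row `i`, with `q = n - i` and `N = i + 1`,
the entries of the left factor are, up to sign, the convolution of `r` with the increments of
`p ↦ √(G (q + p))`, the first increment being `√(G q)` (`nsrLeft_apply`).

Keeping only the first increment bounds the squared norm of the row from below by `G q * G N`; the
middle row has `q ≈ N ≈ n / 2`, so that the error is at least `G (n / 2)`, which is
`alphaInf - log 2 / π + log n / π + o(1)`.

For the upper bound there are two kinds of rows. If `q > n / 32`, the other increments are `O(1/q)`
and contribute a vector of norm `o(1)`, while `√(G q * G N)` is at most the arithmetic mean, which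
is at most `G ((n + 2) / 2)` by concavity (`sqrt_sum_sq_leftEntry_le`). If `q ≤ n / 32`, the row is
a nonnegative combination of shifts of `r` with weights of total mass `√(G n)`, so its squared norm
is at most `(G n)²`. This is too large by `(2 log 2 / π) G n` to first order, but shifts that are
`Q = n / 32` or more apart have an inner product smaller than `G N` by about `G Q`, and enough of
the mass sits on such pairs to gain `(log (32 / 3) / π) G n`
(`sum_sq_leftEntry_le`, `eventually_bottom_le`).

The limit of `alpha` exists because Wallis' product gives
`1 / (π (k + 1/2)) ≤ (r k)² ≤ 1 / (π (k + 1/4))`, which makes `G (n + 1) - log (n + 3/4) / π`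
decreasing and bounded below; its value at `n = 15` is already a sharp enough numerical upper bound
for the limit (`alphaInf_le`).
-/

noncomputable section

namespace NSR

/-! ### The sequence `r` and its sums of squares -/

theorem r_zero : r 0 = 1 := by simp [r]

theorem r_pos (k : ℕ) : 0 < r k := by
  have := Nat.centralBinom_pos k
  unfold r
  positivity

theorem r_succ (k : ℕ) : (2 * k + 2) * r (k + 1) = (2 * k + 1) * r k := by
  have h : ((k : ℝ) + 1) * (Nat.centralBinom (k + 1) : ℝ)
      = 2 * (2 * k + 1) * Nat.centralBinom k := by
    exact_mod_cast Nat.succ_mul_centralBinom_succ k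
  unfold r
  rw [pow_succ]
  field_simp
  linarith

theorem r_antitone : Antitone r := by
  refine antitone_nat_of_succ_le fun k => ?_
  have h := r_succ k
  have hr := r_pos k
  have : (0 : ℝ) ≤ k := k.cast_nonneg
  nlinarith

theorem sum_range_r (m : ℕ) : ∑ p ∈ Finset.range m, r p = 2 * m * r m := by
  induction m with
  | zero => simp
  | succ m ih =>
    rw [Finset.sum_range_succ, ih]
    have := r_succ m
    push_cast
    linarith

theorem r_sq_mul_wallis (k : ℕ) : r k ^ 2 * (2 * k + 1) * Real.Wallis.W k = 1 := by
  induction k with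
  | zero => simp [r_zero, Real.Wallis.W]
  | succ k ih =>
    have h : r (k + 1) = (2 * k + 1) * r k / (2 * k + 2) := by
      rw [eq_div_iff (by positivity), ← r_succ]
      ring
    have hk : (0 : ℝ) ≤ k := k.cast_nonneg
    rw [Real.Wallis.W_succ, h]
    refine Eq.trans ?_ ih
    push_cast
    field_simp
    ring

theorem r_sq_ge (k : ℕ) : 1 / (Real.pi * (k + 1 / 2)) ≤ r k ^ 2 := by
  have h := r_sq_mul_wallis k
  have hW := Real.Wallis.W_le k
  have hr := pow_pos (r_pos k) 2
  have hp := Real.pi_pos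
  rw [div_le_iff₀ (by positivity)]
  calc 1 = r k ^ 2 * (2 * k + 1) * Real.Wallis.W k := h.symm
    _ ≤ r k ^ 2 * (2 * k + 1) * (Real.pi / 2) := by gcongr
    _ = _ := by ring

/-- `(r k)² (k + 1/4)` increases to `1 / π`. -/
theorem r_sq_le (k : ℕ) : r k ^ 2 ≤ 1 / (Real.pi * (k + 1 / 4)) := by
  have hmono : Monotone fun k : ℕ => r k ^ 2 * ((k : ℝ) + 1 / 4) := by
    refine monotone_nat_of_le_succ fun k => ?_
    have h : r (k + 1) = (2 * k + 1) * r k / (2 * k + 2) := by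
      rw [eq_div_iff (by positivity), ← r_succ]
      ring
    have hr := pow_pos (r_pos k) 2
    rw [h, div_pow, mul_pow, div_mul_eq_mul_div, le_div_iff₀ (by positivity)]
    push_cast
    nlinarith
  have hlim : Tendsto (fun k : ℕ => r k ^ 2 * ((k : ℝ) + 1 / 4)) atTop (𝓝 (1 / Real.pi)) := by
    have h1 : Tendsto (fun k : ℕ => ((k : ℝ) + 1 / 4) / (2 * k + 1)) atTop (𝓝 (1 / 2)) := by
      have h2 : Tendsto (fun k : ℕ => (1 : ℝ) / 2 - 1 / 8 * (1 / ((k : ℝ) + 1 / 2)))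
          atTop (𝓝 (1 / 2 - 1 / 8 * 0)) := by
        refine tendsto_const_nhds.sub (Tendsto.const_mul _ ?_)
        refine tendsto_const_nhds.div_atTop ?_
        exact tendsto_atTop_add_const_right _ _ tendsto_natCast_atTop_atTop
      rw [mul_zero, sub_zero] at h2
      refine h2.congr fun k => ?_
      have : (0 : ℝ) ≤ k := k.cast_nonneg
      field_simp
      ring
    have h3 := h1.div Real.Wallis.tendsto_W_nhds_pi_div_two (by positivity)
    have h4 : (1 : ℝ) / 2 / (Real.pi / 2) = 1 / Real.pi := by field_simp
    rw [h4] at h3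
    refine h3.congr fun k => ?_
    have hW := Real.Wallis.W_pos k
    have := r_sq_mul_wallis k
    simp only [Pi.div_apply]
    rw [div_div, div_eq_iff (by positivity)]
    linear_combination (-(k : ℝ) - 1 / 4) * this
  have h := hmono.ge_of_tendsto hlim k
  rw [← div_div, le_div_iff₀ (by positivity)]
  exact h

/-- The partial sums `G n = ∑_{j < n} (r j)²`, the squared Euclidean norms of the columns of the
Toeplitz matrix with entries `r (i - j)`. -/
def G (n : ℕ) : ℝ := ∑ j ∈ Finset.range n, r j ^ 2

theorem G_succ (n : ℕ) : G (n + 1) = G n + r n ^ 2 := Finset.sum_range_succ _ _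

theorem G_mono : Monotone G :=
  monotone_nat_of_le_succ fun n => by rw [G_succ]; linarith [sq_nonneg (r n)]

theorem G_nonneg (n : ℕ) : 0 ≤ G n := Finset.sum_nonneg fun _ _ => sq_nonneg _

theorem one_le_G {n : ℕ} (hn : 1 ≤ n) : 1 ≤ G n := by
  have h : G 1 = 1 := by simp [G, r_zero]
  exact h ▸ G_mono hn

theorem G_sub {a b : ℕ} (h : a ≤ b) : G b - G a = ∑ j ∈ Finset.Ico a b, r j ^ 2 := by
  rw [G, G, Finset.sum_Ico_eq_sub _ h]

/-- Discrete midpoint concavity of `G`, which holds because `r` decreases. -/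
theorem G_add_G_le {a b h : ℕ} (hab : a + b ≤ 2 * h) : G a + G b ≤ 2 * G h := by
  wlog hle : a ≤ b generalizing a b
  · rw [add_comm]
    exact this (by omega) (by omega)
  rcases le_or_gt b h with hb | hb
  · linarith [G_mono hb, G_mono (hle.trans hb)]
  have ha : a ≤ h := by omega
  have h1 : ((h - a : ℕ) : ℝ) * r h ^ 2 ≤ G h - G a := by
    rw [G_sub ha, ← nsmul_eq_mul, ← Nat.card_Ico]
    refine Finset.card_nsmul_le_sum _ _ _ fun j hj => ?_
    have := (Finset.mem_Ico.mp hj).2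
    exact pow_le_pow_left₀ (r_pos _).le (r_antitone this.le) 2
  have h2 : G b - G h ≤ ((b - h : ℕ) : ℝ) * r h ^ 2 := by
    rw [G_sub hb.le, ← nsmul_eq_mul, ← Nat.card_Ico]
    refine Finset.sum_le_card_nsmul _ _ _ fun j hj => ?_
    have := (Finset.mem_Ico.mp hj).1
    exact pow_le_pow_left₀ (r_pos _).le (r_antitone this) 2
  have h3 : ((b - h : ℕ) : ℝ) ≤ ((h - a : ℕ) : ℝ) := by
    exact_mod_cast (by omega : b - h ≤ h - a)
  nlinarith [sq_nonneg (r h)]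

theorem log_succ_div_pi_le_G (n : ℕ) : Real.log (n + 1) / Real.pi ≤ G n := by
  induction n with
  | zero => simp [G]
  | succ n ih =>
    rw [G_succ]
    have h1 := r_sq_ge n
    have hp := Real.pi_pos
    have h2 : Real.log ((n + 1 : ℕ) + 1) - Real.log (n + 1) ≤ 1 / (n + 1 / 2) := by
      rw [← Real.log_div (by positivity) (by positivity)]
      refine (Real.log_le_sub_one_of_pos (by positivity)).trans ?_
      have e : (((n + 1 : ℕ) : ℝ) + 1) / (n + 1) - 1 = 1 / (n + 1) := by
        push_cast; field_simp; ring
      rw [e]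
      gcongr
      norm_num
    have h3 : 1 / (Real.pi * (n + 1 / 2)) = 1 / (n + 1 / 2) / Real.pi := by
      field_simp
    rw [h3] at h1
    have h4 := div_le_div_of_nonneg_right h2 hp.le
    rw [sub_div] at h4
    linarith

theorem tendsto_G_atTop : Tendsto G atTop atTop := by
  refine tendsto_atTop_mono log_succ_div_pi_le_G ?_
  refine Tendsto.atTop_div_const Real.pi_pos (Real.tendsto_log_atTop.comp ?_)
  exact tendsto_atTop_add_const_right _ _ tendsto_natCast_atTop_atTop

/-- Shifting the argument of the logarithm by `1/4` makes the sequence decreasing. -/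
theorem antitone_G_sub_log :
    Antitone fun n : ℕ => G (n + 1) - Real.log (n + 3 / 4) / Real.pi := by
  refine antitone_nat_of_succ_le fun n => ?_
  rw [G_succ]
  have h1 := r_sq_le (n + 1)
  have hp := Real.pi_pos
  have h2 : 1 / ((n : ℝ) + 5 / 4)
      ≤ Real.log ((n + 1 : ℕ) + 3 / 4) - Real.log (n + 3 / 4) := by
    rw [← Real.log_div (by positivity) (by positivity)]
    have h := Real.le_log_one_add_of_nonneg (x := 1 / ((n : ℝ) + 3 / 4)) (by positivity)
    convert h using 1
    · field_simp; ring
    · congr 1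
      push_cast; field_simp; ring
  have h3 : 1 / (Real.pi * ((n + 1 : ℕ) + 1 / 4)) = 1 / ((n : ℝ) + 5 / 4) / Real.pi := by
    push_cast; field_simp; ring
  rw [h3] at h1
  have h4 := div_le_div_of_nonneg_right h2 hp.le
  rw [sub_div] at h4
  linarith

/-- The limit of `alpha`, as the infimum of a decreasing sequence. -/
def alphaInf : ℝ := ⨅ n : ℕ, (G (n + 1) - Real.log (n + 3 / 4) / Real.pi)

theorem bddBelow_G_sub_log :
    BddBelow (Set.range fun n : ℕ => G (n + 1) - Real.log (n + 3 / 4) / Real.pi) := by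
  refine ⟨0, ?_⟩
  rintro _ ⟨n, rfl⟩
  have h := log_succ_div_pi_le_G (n + 1)
  have h2 : Real.log (n + 3 / 4) / Real.pi ≤ Real.log ((n + 1 : ℕ) + 1) / Real.pi := by
    have := Real.pi_pos
    gcongr
    · linarith
    · norm_num
  simp only
  linarith

theorem tendsto_log_add_sub_log (c : ℝ) :
    Tendsto (fun n : ℕ => Real.log (n + c) - Real.log n) atTop (𝓝 0) := by
  have h : Tendsto (fun n : ℕ => 1 + c / (n : ℝ)) atTop (𝓝 (1 + 0)) :=
    tendsto_const_nhds.add (tendsto_const_div_atTop_nhds_zero_nat c)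
  rw [add_zero] at h
  have h2 := (Real.continuousAt_log one_ne_zero).tendsto.comp h
  rw [Real.log_one] at h2
  refine h2.congr' ?_
  have h3 : Tendsto (fun n : ℕ => (n : ℝ) + c) atTop atTop :=
    tendsto_atTop_add_const_right _ _ tendsto_natCast_atTop_atTop
  filter_upwards [eventually_gt_atTop 0, h3.eventually_gt_atTop 0] with n hn hc
  have hn' : (0 : ℝ) < n := by exact_mod_cast hn
  rw [← Real.log_div hc.ne' hn'.ne', Function.comp_apply]
  congr 1
  field_simp

theorem tendsto_alpha : Tendsto alpha atTop (𝓝 alphaInf) := by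
  have h := tendsto_atTop_ciInf antitone_G_sub_log bddBelow_G_sub_log
  rw [← tendsto_add_atTop_iff_nat 1]
  have h1 := tendsto_log_add_sub_log (3 / 4)
  have h2 := tendsto_log_add_sub_log 1
  have h3 := h.add ((h1.sub h2).div_const Real.pi)
  rw [sub_zero, zero_div, add_zero] at h3
  refine h3.congr fun n => ?_
  rw [alpha, ← G]
  push_cast
  ring

/-- The decreasing sequence that defines `alphaInf`, evaluated at `n = 15`. -/
theorem alphaInf_le : alphaInf ≤ 0.846 + Real.log 2 / Real.pi := by
  have h : alphaInf ≤ G 16 - Real.log (63 / 4) / Real.pi := by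
    have := ciInf_le bddBelow_G_sub_log 15
    norm_num at this
    exact this
  have hG : G 16 ≤ 1.9439 := by
    simp only [G, Finset.sum_range_succ, Finset.sum_range_zero, r, Nat.centralBinom]
    norm_num [Nat.choose_eq_factorial_div_factorial, Nat.factorial]
  have hp := Real.pi_pos
  -- `63 / 4` is close to a power of two
  have hlog : 4 * Real.log 2 - 1 / 63 ≤ Real.log (63 / 4) := by
    have h1 : Real.log (63 / 4) = 4 * Real.log 2 + Real.log (63 / 64) := by
      rw [show (4 : ℝ) * Real.log 2 = Real.log (2 ^ 4) by rw [Real.log_pow]; norm_num,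
        ← Real.log_mul (by norm_num) (by norm_num)]
      norm_num
    have h2 := Real.one_sub_inv_le_log_of_pos (x := 63 / 64) (by norm_num)
    norm_num at h2
    linarith
  have h2 := Real.log_two_gt_d9
  have h3 := Real.pi_lt_d6
  have h4 : (1.098 : ℝ) ≤ (Real.log (63 / 4) + Real.log 2) / Real.pi := by
    rw [le_div_iff₀ hp]
    nlinarith
  rw [add_div] at h4
  linarith

/-! ### The generating function of `r` -/

/-- The generating function of `r`, that is `(1 - x) ^ (-1/2)`. -/
def rSeries : PowerSeries ℝ := PowerSeries.mk r

/-- Proved from the differential equation `2 (1 - x) y' = y`, which gives `(1 - x) (y²)' = y²`. -/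
theorem coeff_rSeries_mul_self (k : ℕ) : PowerSeries.coeff k (rSeries * rSeries) = 1 := by
  have h1 : 2 * PowerSeries.derivative ℝ rSeries
      = rSeries + 2 * (PowerSeries.X * PowerSeries.derivative ℝ rSeries) := by
    have h2 : (2 : PowerSeries ℝ) = PowerSeries.C 2 := (map_ofNat _ 2).symm
    ext k
    rw [map_add, h2, PowerSeries.coeff_C_mul, PowerSeries.coeff_C_mul,
      PowerSeries.coeff_derivative]
    cases k with
    | zero =>
      have := r_succ 0
      simp only [rSeries, PowerSeries.coeff_mk, PowerSeries.coeff_zero_X_mul]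
      push_cast at this ⊢
      linarith
    | succ k =>
      have := r_succ (k + 1)
      simp only [PowerSeries.coeff_succ_X_mul]
      rw [PowerSeries.coeff_derivative]
      simp only [rSeries, PowerSeries.coeff_mk]
      push_cast at this ⊢
      linarith
  have h3 : PowerSeries.derivative ℝ (rSeries * rSeries)
      = rSeries * rSeries + PowerSeries.X * PowerSeries.derivative ℝ (rSeries * rSeries) := by
    have h4 : PowerSeries.derivative ℝ (rSeries * rSeries)
        = rSeries * (2 * PowerSeries.derivative ℝ rSeries) := by
      rw [Derivation.leibniz]
      simp only [smul_eq_mul]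
      ring
    rw [h4]
    linear_combination rSeries * h1
  induction k with
  | zero => simp [rSeries, r_zero]
  | succ k ih =>
    have h5 := congrArg (PowerSeries.coeff k) h3
    rw [map_add, ih, PowerSeries.coeff_derivative] at h5
    have hk : (k : ℝ) + 1 ≠ 0 := by positivity
    refine mul_right_cancel₀ hk ?_
    rw [h5, one_mul]
    cases k with
    | zero => simp
    | succ k =>
      rw [PowerSeries.coeff_succ_X_mul, PowerSeries.coeff_derivative, ih]
      push_cast
      ring

/-! ### Lower triangular Toeplitz matrices -/

/-- The lower triangular Toeplitz matrix whose first column lists the coefficients of `φ`. -/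
def lowerToeplitz (n : ℕ) (φ : PowerSeries ℝ) : Matrix (Fin n) (Fin n) ℝ :=
  Matrix.of fun i j => if j ≤ i then PowerSeries.coeff ((i : ℕ) - j) φ else 0

/-- The product of one row of a lower triangular Toeplitz matrix with another such matrix. -/
theorem sum_toeplitz_row_mul {n : ℕ} (φ ψ : PowerSeries ℝ) (i j : Fin n) :
    ∑ k, lowerToeplitz n φ i k * lowerToeplitz n ψ k j = lowerToeplitz n (φ * ψ) i j := by
  simp only [lowerToeplitz, Matrix.of_apply]
  split_ifs with hij
  · have hij' : (j : ℕ) ≤ i := hij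
    rw [PowerSeries.coeff_mul]
    have hsub : ∑ k : Fin n, ((if k ≤ i then PowerSeries.coeff ((i : ℕ) - k) φ else 0) *
        if j ≤ k then PowerSeries.coeff ((k : ℕ) - j) ψ else 0)
        = ∑ k ∈ Finset.Icc j i,
          PowerSeries.coeff ((i : ℕ) - k) φ * PowerSeries.coeff ((k : ℕ) - j) ψ := by
      rw [← Finset.sum_subset (Finset.subset_univ (Finset.Icc j i))]
      · refine Finset.sum_congr rfl fun k hk => ?_
        rw [if_pos (Finset.mem_Icc.mp hk).2, if_pos (Finset.mem_Icc.mp hk).1]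
      · intro k _ hk
        rw [Finset.mem_Icc, not_and_or] at hk
        rcases hk with hk | hk <;> simp [hk]
    rw [hsub]
    refine Finset.sum_bij (fun k _ => ((i : ℕ) - k, (k : ℕ) - j)) ?_ ?_ ?_ ?_
    · intro k hk
      rw [Finset.mem_Icc, Fin.le_def, Fin.le_def] at hk
      rw [Finset.HasAntidiagonal.mem_antidiagonal]
      omega
    · intro k hk k' hk' h
      rw [Finset.mem_Icc, Fin.le_def, Fin.le_def] at hk hk'
      rw [Prod.mk.injEq] at h
      exact Fin.ext (by omega)
    · intro p hp
      rw [Finset.HasAntidiagonal.mem_antidiagonal] at hp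
      refine ⟨⟨j + p.2, by omega⟩, ?_, ?_⟩
      · rw [Finset.mem_Icc, Fin.le_def, Fin.le_def]
        simp only
        omega
      · ext <;> simp only <;> omega
    · intro k _
      rfl
  · refine Finset.sum_eq_zero fun k _ => ?_
    by_cases h1 : k ≤ i
    · have h2 : ¬ j ≤ k := fun h2 => hij (h2.trans h1)
      simp [h2]
    · simp [h1]

theorem lowerToeplitz_mul (n : ℕ) (φ ψ : PowerSeries ℝ) :
    lowerToeplitz n φ * lowerToeplitz n ψ = lowerToeplitz n (φ * ψ) := by
  ext i j
  rw [Matrix.mul_apply, sum_toeplitz_row_mul]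

theorem Mcount_eq_lowerToeplitz (n : ℕ) :
    Mcount n = lowerToeplitz n (rSeries * rSeries) := by
  ext i j
  simp only [Mcount, lowerToeplitz, Matrix.of_apply, coeff_rSeries_mul_self]

/-- The nilpotent matrix with ones on the first subdiagonal. -/
def lowerShift (n : ℕ) : Matrix (Fin n) (Fin n) ℝ :=
  Matrix.of fun i j => if (i : ℕ) = j + 1 then 1 else 0

theorem mul_lowerShift_apply {n : ℕ} (A : Matrix (Fin n) (Fin n) ℝ) (i j : Fin n) :
    (A * lowerShift n) i j = if h : (j : ℕ) + 1 < n then A i ⟨j + 1, h⟩ else 0 := by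
  rw [Matrix.mul_apply]
  simp only [lowerShift, Matrix.of_apply, mul_ite, mul_one, mul_zero]
  split_ifs with h
  · rw [Finset.sum_eq_single ⟨j + 1, h⟩]
    · simp
    · intro k _ hk
      rw [if_neg fun h' => hk (Fin.ext h')]
    · simp
  · refine Finset.sum_eq_zero fun k _ => ?_
    rw [if_neg (by omega)]

theorem lowerShift_mul_apply_succ {n : ℕ} (A : Matrix (Fin n) (Fin n) ℝ) (i : ℕ)
    (hi : i + 1 < n) (j : Fin n) :
    (lowerShift n * A) ⟨i + 1, hi⟩ j = A ⟨i, by omega⟩ j := by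
  rw [Matrix.mul_apply]
  simp only [lowerShift, Matrix.of_apply, ite_mul, one_mul, zero_mul]
  rw [Finset.sum_eq_single ⟨i, by omega⟩]
  · simp
  · intro k _ hk
    rw [if_neg fun h' => hk (Fin.ext (by simp only; omega))]
  · simp

theorem lowerShift_mul_apply_zero {n : ℕ} (A : Matrix (Fin n) (Fin n) ℝ) (h : 0 < n)
    (j : Fin n) : (lowerShift n * A) ⟨0, h⟩ j = 0 := by
  rw [Matrix.mul_apply]
  refine Finset.sum_eq_zero fun k _ => ?_
  simp [lowerShift]

theorem Mcount_mul_one_sub_lowerShift (n : ℕ) : Mcount n * (1 - lowerShift n) = 1 := by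
  ext i j
  rw [Matrix.mul_sub, Matrix.mul_one, Matrix.sub_apply, mul_lowerShift_apply, Matrix.one_apply]
  simp only [Mcount, Matrix.of_apply, Fin.le_def, Fin.ext_iff]
  split_ifs <;> first | omega | norm_num

/-- A matrix that commutes with the prefix-sum matrix commutes with its inverse, hence with the
shift, so that its entries are constant along diagonals and vanish above the main one. -/
theorem exists_eq_lowerToeplitz_of_commute {n : ℕ} {A : Matrix (Fin n) (Fin n) ℝ}
    (h : Commute A (Mcount n)) : ∃ φ, A = lowerToeplitz n φ := by
  have h1 := Mcount_mul_one_sub_lowerShift n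
  have h2 : (1 - lowerShift n) * Mcount n = 1 := mul_eq_one_comm.mp h1
  have hS : A * lowerShift n = lowerShift n * A := by
    have h3 : A * (1 - lowerShift n) = (1 - lowerShift n) * A := by
      calc A * (1 - lowerShift n)
          = (1 - lowerShift n) * (Mcount n * A) * (1 - lowerShift n) := by
            rw [← Matrix.mul_assoc, h2, Matrix.one_mul]
        _ = (1 - lowerShift n) * A * (Mcount n * (1 - lowerShift n)) := by
            rw [← h.eq]; simp only [Matrix.mul_assoc]
        _ = (1 - lowerShift n) * A := by rw [h1, Matrix.mul_one]
    rw [Matrix.mul_sub, Matrix.sub_mul, Matrix.mul_one, Matrix.one_mul] at h3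
    exact sub_right_injective h3
  refine ⟨PowerSeries.mk fun k => if hk : k < n then A ⟨k, hk⟩ ⟨0, by omega⟩ else 0, ?_⟩
  have key : ∀ (j i : ℕ) (hj : j < n) (hi : i < n), A ⟨i, hi⟩ ⟨j, hj⟩
      = if j ≤ i then A ⟨i - j, by omega⟩ ⟨0, by omega⟩ else 0 := by
    intro j
    induction j with
    | zero => intro i hj hi; simp
    | succ j ih =>
      intro i hj hi
      have h4 := mul_lowerShift_apply A ⟨i, hi⟩ ⟨j, by omega⟩
      rw [dif_pos hj, hS] at h4
      cases i with
      | zero =>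
        rw [lowerShift_mul_apply_zero] at h4
        rw [← h4]
        simp
      | succ i =>
        rw [lowerShift_mul_apply_succ, ih] at h4
        rw [← h4]
        simp
  ext i j
  rw [key j i j.2 i.2]
  simp only [lowerToeplitz, Matrix.of_apply, PowerSeries.coeff_mk, Fin.le_def]
  split_ifs with h3 h4
  · rfl
  · omega
  · rfl

/-- The square root of the prefix-sum matrix is unique up to sign. With `C = lowerToeplitz n φ`,
`(φ - σ ρ) (φ + σ ρ) = 0` modulo `x ^ n` for `ρ` the generating function of `r`; for the sign
`σ` of the diagonal of `C` the second factor is a unit. -/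
theorem eq_lowerToeplitz_of_mul_self_eq {n : ℕ} {C : Matrix (Fin n) (Fin n) ℝ}
    (hC : C * C = Mcount n) :
    ∃ σ : ℝ, σ ^ 2 = 1 ∧ C = σ • lowerToeplitz n rSeries := by
  rcases Nat.eq_zero_or_pos n with rfl | hn
  · exact ⟨1, by norm_num, Subsingleton.elim _ _⟩
  have hcomm : Commute C (Mcount n) := by
    rw [← hC]
    exact (Commute.refl C).mul_right (Commute.refl C)
  obtain ⟨φ, rfl⟩ := exists_eq_lowerToeplitz_of_commute hcomm
  rw [lowerToeplitz_mul, Mcount_eq_lowerToeplitz] at hC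
  have hcoeff : ∀ k < n, PowerSeries.coeff k (φ * φ) = 1 := by
    intro k hk
    have := congrFun (congrFun hC ⟨k, hk⟩) ⟨0, hn⟩
    simpa only [lowerToeplitz, Matrix.of_apply, coeff_rSeries_mul_self, Fin.le_def,
      Nat.zero_le, if_true, Nat.sub_zero] using this
  set σ := PowerSeries.constantCoeff φ with hσ
  have hσ2 : σ ^ 2 = 1 := by
    have := hcoeff 0 hn
    rw [PowerSeries.coeff_zero_eq_constantCoeff, map_mul] at this
    rw [sq, this]
  refine ⟨σ, hσ2, ?_⟩
  have hσ0 : σ ≠ 0 := by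
    intro h
    simp [h] at hσ2
  have hunit : IsUnit (φ + PowerSeries.C σ * rSeries) := by
    rw [PowerSeries.isUnit_iff_constantCoeff]
    have : PowerSeries.constantCoeff (φ + PowerSeries.C σ * rSeries) = 2 * σ := by
      rw [map_add, map_mul, ← hσ]
      simp [rSeries, r_zero]
      ring
    rw [this]
    exact (mul_ne_zero two_ne_zero hσ0).isUnit
  have hdvd : (PowerSeries.X : PowerSeries ℝ) ^ n ∣ φ - PowerSeries.C σ * rSeries := by
    rw [← hunit.dvd_mul_right, PowerSeries.X_pow_dvd_iff]
    intro k hk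
    have e : (φ - PowerSeries.C σ * rSeries) * (φ + PowerSeries.C σ * rSeries)
        = φ * φ - PowerSeries.C (σ ^ 2) * (rSeries * rSeries) := by
      rw [map_pow]; ring
    rw [e, hσ2, map_one, one_mul, map_sub, hcoeff k hk, coeff_rSeries_mul_self, sub_self]
  ext i j
  rw [PowerSeries.X_pow_dvd_iff] at hdvd
  have := hdvd (i - j) (by omega)
  rw [map_sub, PowerSeries.coeff_C_mul, sub_eq_zero] at this
  simp [lowerToeplitz, this]

theorem colNorm_nonneg {m n : ℕ} (A : Matrix (Fin m) (Fin n) ℝ) (j : Fin n) :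
    0 ≤ colNorm A j := norm_nonneg _

theorem rowNorm_nonneg {m n : ℕ} (A : Matrix (Fin m) (Fin n) ℝ) (i : Fin m) :
    0 ≤ rowNorm A i := norm_nonneg _

theorem sq_colNorm {m n : ℕ} (A : Matrix (Fin m) (Fin n) ℝ) (j : Fin n) :
    colNorm A j ^ 2 = ∑ i, A i j ^ 2 := by
  rw [colNorm, EuclideanSpace.norm_sq_eq]
  simp

theorem sq_rowNorm {m n : ℕ} (A : Matrix (Fin m) (Fin n) ℝ) (i : Fin m) :
    rowNorm A i ^ 2 = ∑ j, A i j ^ 2 := by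
  rw [rowNorm, EuclideanSpace.norm_sq_eq]
  simp

theorem colNorm_smul_toeplitz {n : ℕ} {σ : ℝ} (hσ : σ ^ 2 = 1) (j : Fin n) :
    colNorm (σ • lowerToeplitz n rSeries) j = √(G (n - j)) := by
  rw [← Real.sqrt_sq (colNorm_nonneg _ _), sq_colNorm]
  congr 1
  simp only [Matrix.smul_apply, smul_eq_mul, mul_pow, hσ, one_mul, lowerToeplitz, Matrix.of_apply,
    rSeries, PowerSeries.coeff_mk, Fin.le_def, ite_pow]
  rw [Fin.sum_univ_eq_sum_range
    (fun i => if (j : ℕ) ≤ i then r (i - j) ^ 2 else (0 : ℝ) ^ 2) n, G,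
    ← Finset.sum_range_add_sum_Ico _ j.2.le, Finset.sum_eq_zero, zero_add,
    Finset.sum_Ico_eq_sum_range]
  · refine Finset.sum_congr rfl fun k _ => ?_
    simp
  · intro k hk
    rw [Finset.mem_range] at hk
    rw [if_neg (by omega)]
    norm_num

/-! ### The rows of the left factor -/

/-- The increments along `p` of `p ↦ √(G (q + p))`, the first one being `√(G q)` itself. With
`q = n - i` these are the increments of the column norms of `C`, read to the left from column
`i`. -/
def incr (q p : ℕ) : ℝ := if p = 0 then √(G q) else √(G (q + p)) - √(G (q + p - 1))

theorem sum_range_incr (q m : ℕ) : ∑ p ∈ Finset.range (m + 1), incr q p = √(G (q + m)) := by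
  induction m with
  | zero => simp [incr]
  | succ m ih =>
    rw [Finset.sum_range_succ, ih, incr, if_neg (by omega)]
    simp only [← add_assoc, Nat.add_sub_cancel]
    ring

theorem incr_nonneg (q p : ℕ) : 0 ≤ incr q p := by
  unfold incr
  split_ifs
  · positivity
  · exact sub_nonneg.mpr (Real.sqrt_le_sqrt (G_mono (by omega)))

/-- The convolution of `incr q` with `r`. For `q = n - i` the entry `(i, j)` of the left factor
is, up to sign, `leftEntry q (i - j)`. -/
def leftEntry (q m : ℕ) : ℝ := ∑ p ∈ Finset.range (m + 1), incr q p * r (m - p)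

theorem leftEntry_eq_coeff (q m : ℕ) :
    leftEntry q m = PowerSeries.coeff m (PowerSeries.mk (incr q) * rSeries) := by
  rw [PowerSeries.coeff_mul, Finset.Nat.sum_antidiagonal_eq_sum_range_succ_mk]
  simp [leftEntry, rSeries]

theorem nsrLeft_apply {n : ℕ} {C : Matrix (Fin n) (Fin n) ℝ} (hC : C * C = Mcount n)
    {σ : ℝ} (hσ : σ ^ 2 = 1) (hCσ : C = σ • lowerToeplitz n rSeries) (i j : Fin n) :
    nsrLeft C i j = if j ≤ i then σ * leftEntry (n - i) (i - j) else 0 := by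
  have hR := det_nsrRight_ne_zero hC
  set E : Matrix (Fin n) (Fin n) ℝ :=
    Matrix.of fun i j => if j ≤ i then σ * leftEntry (n - i) (i - j) else 0 with hE
  have hdpos : ∀ j, 0 < colNorm C j := by
    intro j
    rw [hCσ, colNorm_smul_toeplitz hσ]
    exact Real.sqrt_pos.mpr (one_pos.trans_le (one_le_G (by omega)))
  have hD : IsUnit (nsrD C).det := by
    rw [nsrD, Matrix.det_diagonal]
    exact (Finset.prod_pos fun j _ => hdpos j).ne'.isUnit
  -- the convolution of `r` with itself is constantly `1`, so the product sums the increments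
  have hEC : E * C = Mcount n * nsrD C := by
    ext i j
    have hrow : ∀ k, E i k = σ * lowerToeplitz n (PowerSeries.mk (incr (n - i)) * rSeries) i k := by
      intro k
      simp only [hE, lowerToeplitz, Matrix.of_apply, leftEntry_eq_coeff, mul_ite, mul_zero]
    rw [Matrix.mul_apply, nsrD, Matrix.mul_diagonal, hCσ, colNorm_smul_toeplitz hσ]
    have : ∀ k, E i k * (σ • lowerToeplitz n rSeries) k j
        = lowerToeplitz n (PowerSeries.mk (incr (n - i)) * rSeries) i k
          * lowerToeplitz n rSeries k j := by
      intro k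
      rw [hrow, Matrix.smul_apply, smul_eq_mul]
      linear_combination (lowerToeplitz n (PowerSeries.mk (incr (n - i)) * rSeries) i k
          * lowerToeplitz n rSeries k j) * hσ
    rw [Finset.sum_congr rfl fun k _ => this k, sum_toeplitz_row_mul, mul_assoc]
    simp only [lowerToeplitz, Mcount, Matrix.of_apply]
    split_ifs with hij
    · rw [PowerSeries.coeff_mul, Finset.Nat.sum_antidiagonal_eq_sum_range_succ_mk]
      simp only [PowerSeries.coeff_mk, coeff_rSeries_mul_self, mul_one, one_mul, sum_range_incr]
      have : (j : ℕ) ≤ i := hij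
      congr 2
      omega
    · simp
  have hER : E * nsrRight C = Mcount n := by
    rw [nsrRight, ← Matrix.mul_assoc, hEC, Matrix.mul_assoc, Matrix.mul_nonsing_inv _ hD,
      Matrix.mul_one]
  have : nsrLeft C = E := by
    rw [nsrLeft, ← hER, Matrix.mul_assoc, Matrix.mul_nonsing_inv _ hR.isUnit, Matrix.mul_one]
  rw [this]
  rfl

theorem sq_rowNorm_nsrLeft {n : ℕ} {C : Matrix (Fin n) (Fin n) ℝ} (hC : C * C = Mcount n)
    (i : Fin n) :
    rowNorm (nsrLeft C) i ^ 2 = ∑ m ∈ Finset.range (i + 1), leftEntry (n - i) m ^ 2 := by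
  obtain ⟨σ, hσ, hCσ⟩ := eq_lowerToeplitz_of_mul_self_eq hC
  rw [sq_rowNorm]
  simp only [nsrLeft_apply hC hσ hCσ, Fin.le_def]
  rw [Fin.sum_univ_eq_sum_range
    (fun j => (if j ≤ (i : ℕ) then σ * leftEntry (n - i) (i - j) else 0) ^ 2) n,
    ← Finset.sum_range_add_sum_Ico _ (by omega : (i : ℕ) + 1 ≤ n),
    Finset.sum_eq_zero (s := Finset.Ico _ _), add_zero,
    ← Finset.sum_range_reflect (fun m => leftEntry (n - i) m ^ 2)]
  · refine Finset.sum_congr rfl fun k hk => ?_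
    rw [Finset.mem_range] at hk
    rw [if_pos (by omega), mul_pow, hσ, one_mul]
    congr 2
  · intro k hk
    rw [Finset.mem_Ico] at hk
    rw [if_neg (by omega)]
    norm_num

/-- The columns of the right factor have norm `1`, so the error is the largest row norm of the
left factor. -/
theorem maxSE_nsr {n : ℕ} (hn : 1 ≤ n) {C : Matrix (Fin n) (Fin n) ℝ} (hC : C * C = Mcount n) :
    maxSE (nsrLeft C) (nsrRight C) = ⨆ i, rowNorm (nsrLeft C) i := by
  obtain ⟨σ, hσ, hCσ⟩ := eq_lowerToeplitz_of_mul_self_eq hC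
  have : Nonempty (Fin n) := ⟨⟨0, hn⟩⟩
  have hdpos : ∀ j, 0 < colNorm C j := by
    intro j
    rw [hCσ, colNorm_smul_toeplitz hσ]
    exact Real.sqrt_pos.mpr (one_pos.trans_le (one_le_G (by omega)))
  have hcol : ∀ j, colNorm (nsrRight C) j = 1 := by
    intro j
    have hinv : (nsrD C)⁻¹ = Matrix.diagonal fun j => (colNorm C j)⁻¹ := by
      refine Matrix.inv_eq_right_inv ?_
      rw [nsrD, Matrix.diagonal_mul_diagonal, ← Matrix.diagonal_one]
      congr 1
      ext j
      exact mul_inv_cancel₀ (hdpos j).ne'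
    rw [← Real.sqrt_sq (colNorm_nonneg (nsrRight C) j), sq_colNorm, nsrRight, hinv]
    simp only [Matrix.mul_diagonal, mul_pow]
    rw [← Finset.sum_mul, ← sq_colNorm, ← mul_pow, mul_inv_cancel₀ (hdpos j).ne', one_pow,
      Real.sqrt_one]
  rw [maxSE_eq (nsrLeft_mul_nsrRight hC)]
  simp only [hcol, ciSup_const, mul_one]

/-! ### Bounds for the row norms -/

theorem sqrt_G_mul_r_le_leftEntry (q m : ℕ) : √(G q) * r m ≤ leftEntry q m := by
  rw [leftEntry, Finset.sum_range_succ']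
  have h : 0 ≤ ∑ p ∈ Finset.range m, incr q (p + 1) * r (m - (p + 1)) :=
    Finset.sum_nonneg fun p _ => mul_nonneg (incr_nonneg _ _) (r_pos _).le
  simpa [incr] using h

theorem G_mul_G_le_sum_sq_leftEntry (q N : ℕ) :
    G q * G N ≤ ∑ m ∈ Finset.range N, leftEntry q m ^ 2 := by
  rw [G, G, ← G, Finset.mul_sum]
  refine Finset.sum_le_sum fun m _ => ?_
  calc G q * r m ^ 2 = (√(G q) * r m) ^ 2 := by rw [mul_pow, Real.sq_sqrt (G_nonneg q)]
    _ ≤ _ := pow_le_pow_left₀ (mul_nonneg (Real.sqrt_nonneg _) (r_pos _).le)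
      (sqrt_G_mul_r_le_leftEntry q m) 2

theorem incr_succ_le {q : ℕ} (hq : 1 ≤ q) (p : ℕ) : incr q (p + 1) ≤ r q ^ 2 / √(G q) := by
  have hG : 0 < √(G q) := Real.sqrt_pos.mpr (one_pos.trans_le (one_le_G hq))
  rw [incr, if_neg (by omega), le_div_iff₀ hG, ← add_assoc, Nat.add_sub_cancel]
  have h1 : √(G q) ≤ √(G (q + p)) := Real.sqrt_le_sqrt (G_mono (by omega))
  have h2 : √(G (q + p)) ≤ √(G (q + p + 1)) := Real.sqrt_le_sqrt (G_mono (by omega))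
  have h3 := Real.sq_sqrt (G_nonneg (q + p))
  have h4 := Real.sq_sqrt (G_nonneg (q + p + 1))
  have h5 : r (q + p) ^ 2 ≤ r q ^ 2 :=
    pow_le_pow_left₀ (r_pos _).le (r_antitone (by omega)) 2
  rw [G_succ] at h4 h2 ⊢
  nlinarith

theorem r_sq_mul_le_one (m : ℕ) : m * r m ^ 2 ≤ 1 / 2 := by
  have h := r_sq_le m
  have hp := Real.pi_gt_three
  have hm : (0 : ℝ) ≤ m := m.cast_nonneg
  calc m * r m ^ 2 ≤ m * (1 / (Real.pi * (m + 1 / 4))) := by gcongr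
    _ ≤ 1 / 2 := by
      rw [mul_one_div, div_le_div_iff₀ (by positivity) (by norm_num)]
      nlinarith

/-- All increments but the first are `O(1 / q)`; together they add only a term of norm
`O(N / (q √(G q)))` to the main term `√(G q) r`. -/
theorem leftEntry_sub_le {q : ℕ} (hq : 1 ≤ q) (m : ℕ) :
    (leftEntry q m - √(G q) * r m) ^ 2 ≤ m / (q ^ 2 * G q) := by
  have hG := one_pos.trans_le (one_le_G hq)
  have h0 : leftEntry q m - √(G q) * r m
      = ∑ p ∈ Finset.range m, incr q (p + 1) * r (m - (p + 1)) := by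
    rw [leftEntry, Finset.sum_range_succ']
    simp [incr]
  have h1 : leftEntry q m - √(G q) * r m ≤ r q ^ 2 / √(G q) * (2 * m * r m) := by
    rw [h0, ← sum_range_r, ← Finset.sum_range_reflect r, Finset.mul_sum]
    refine Finset.sum_le_sum fun p _ => ?_
    rw [show m - 1 - p = m - (p + 1) by omega]
    exact mul_le_mul_of_nonneg_right (incr_succ_le hq p) (r_pos _).le
  have h2 : 0 ≤ leftEntry q m - √(G q) * r m := sub_nonneg.mpr (sqrt_G_mul_r_le_leftEntry q m)
  have h3 := r_sq_mul_le_one q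
  have h4 := r_sq_mul_le_one m
  have hq' : (0 : ℝ) < q := by exact_mod_cast hq
  have hm : (0 : ℝ) ≤ m := m.cast_nonneg
  calc (leftEntry q m - √(G q) * r m) ^ 2
      ≤ (r q ^ 2 / √(G q) * (2 * m * r m)) ^ 2 := pow_le_pow_left₀ h2 h1 2
    _ = (q * r q ^ 2) ^ 2 * (4 * m * (m * r m ^ 2)) / (q ^ 2 * G q) := by
      rw [mul_pow, div_pow, Real.sq_sqrt hG.le]
      field_simp
      ring
    _ ≤ (1 / 2) ^ 2 * (4 * m * (1 / 2)) / (q ^ 2 * G q) := by gcongr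
    _ ≤ m / (q ^ 2 * G q) := by
      gcongr
      linarith

theorem sqrt_sum_add_sq_le {ι : Type*} (s : Finset ι) (a b : ι → ℝ) :
    √(∑ i ∈ s, (a i + b i) ^ 2) ≤ √(∑ i ∈ s, a i ^ 2) + √(∑ i ∈ s, b i ^ 2) := by
  have hA : 0 ≤ ∑ i ∈ s, a i ^ 2 := Finset.sum_nonneg fun _ _ => sq_nonneg _
  have hB : 0 ≤ ∑ i ∈ s, b i ^ 2 := Finset.sum_nonneg fun _ _ => sq_nonneg _
  rw [Real.sqrt_le_left (by positivity), add_sq, Real.sq_sqrt hA, Real.sq_sqrt hB]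
  have h := Real.sum_mul_le_sqrt_mul_sqrt s a b
  have e : ∑ i ∈ s, (a i + b i) ^ 2
      = ∑ i ∈ s, a i ^ 2 + 2 * ∑ i ∈ s, a i * b i + ∑ i ∈ s, b i ^ 2 := by
    rw [Finset.mul_sum, ← Finset.sum_add_distrib, ← Finset.sum_add_distrib]
    exact Finset.sum_congr rfl fun i _ => by ring
  linarith

/-- The bound for the rows away from the bottom, where `N / q` is bounded. -/
theorem sqrt_sum_sq_leftEntry_le {q : ℕ} (hq : 1 ≤ q) (N : ℕ) :
    √(∑ m ∈ Finset.range N, leftEntry q m ^ 2) ≤ (G q + G N) / 2 + N / (q * √(G q)) := by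
  have hG := one_pos.trans_le (one_le_G hq)
  have h := sqrt_sum_add_sq_le (Finset.range N) (fun m => √(G q) * r m)
    (fun m => leftEntry q m - √(G q) * r m)
  simp only [add_sub_cancel] at h
  refine h.trans (add_le_add ?_ ?_)
  · simp only [mul_pow, Real.sq_sqrt hG.le]
    rw [← Finset.mul_sum, ← G, Real.sqrt_le_left (by linarith [G_nonneg N])]
    nlinarith [sq_nonneg (G q - G N)]
  · rw [Real.sqrt_le_left (by positivity), div_pow, mul_pow, Real.sq_sqrt hG.le]
    calc ∑ m ∈ Finset.range N, (leftEntry q m - √(G q) * r m) ^ 2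
        ≤ ∑ m ∈ Finset.range N, (N : ℝ) / (q ^ 2 * G q) := by
          refine Finset.sum_le_sum fun m hm => (leftEntry_sub_le hq m).trans ?_
          have := (Finset.mem_range.mp hm).le
          gcongr
      _ = (N : ℝ) ^ 2 / (q ^ 2 * G q) := by
          rw [Finset.sum_const, Finset.card_range, nsmul_eq_mul]
          ring

/-- The sequence `r` shifted to the right by `p` places. -/
def shiftR (p m : ℕ) : ℝ := if p ≤ m then r (m - p) else 0

theorem leftEntry_eq_sum_shiftR (q : ℕ) {m N : ℕ} (hm : m < N) :
    leftEntry q m = ∑ p ∈ Finset.range N, incr q p * shiftR p m := by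
  rw [leftEntry, ← Finset.sum_range_add_sum_Ico _ (by omega : m + 1 ≤ N),
    Finset.sum_eq_zero (s := Finset.Ico _ _), add_zero]
  · refine Finset.sum_congr rfl fun p hp => ?_
    rw [Finset.mem_range] at hp
    rw [shiftR, if_pos (by omega)]
  · intro p hp
    rw [Finset.mem_Ico] at hp
    rw [shiftR, if_neg (by omega), mul_zero]

theorem sum_shiftR_mul_shiftR_le (N p d : ℕ) :
    ∑ m ∈ Finset.range N, shiftR p m * shiftR (p + d) m
      ≤ ∑ k ∈ Finset.range N, r (k + d) * r k := by
  have h : ∑ m ∈ Finset.range N, shiftR p m * shiftR (p + d) m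
      = ∑ k ∈ Finset.range (N - (p + d)), r (k + d) * r k := by
    induction N with
    | zero => simp
    | succ N ih =>
      rw [Finset.sum_range_succ, ih]
      by_cases hN : p + d ≤ N
      · rw [show N + 1 - (p + d) = N - (p + d) + 1 by omega, Finset.sum_range_succ, shiftR,
          shiftR, if_pos (by omega), if_pos hN,
          show N - (p + d) + d = N - p by omega]
      · rw [show N + 1 - (p + d) = N - (p + d) by omega, shiftR, shiftR, if_neg hN, mul_zero,
          add_zero]
  rw [h]
  exact Finset.sum_le_sum_of_subset_of_nonneg (Finset.range_mono (by omega))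
    fun k _ _ => (mul_pos (r_pos _) (r_pos _)).le

theorem sum_r_add_mul_r_le_G (N d : ℕ) : ∑ k ∈ Finset.range N, r (k + d) * r k ≤ G N := by
  refine Finset.sum_le_sum fun k _ => ?_
  rw [sq]
  exact mul_le_mul_of_nonneg_right (r_antitone (by omega)) (r_pos _).le

/-- Shifts of `r` that lie at least `Q` apart have an inner product smaller than the squared norm
by about `G Q`. -/
theorem sum_r_add_mul_r_le {N Q d : ℕ} (hQ : Q ≤ N) (hd : Q ≤ d) :
    ∑ k ∈ Finset.range N, r (k + d) * r k ≤ G N - (G Q - 1) := by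
  rw [← Finset.sum_range_add_sum_Ico _ hQ]
  have h1 : ∑ k ∈ Finset.range Q, r (k + d) * r k ≤ 1 := by
    calc ∑ k ∈ Finset.range Q, r (k + d) * r k ≤ ∑ k ∈ Finset.range Q, r Q * r k := by
          refine Finset.sum_le_sum fun k _ => ?_
          exact mul_le_mul_of_nonneg_right (r_antitone (by omega)) (r_pos _).le
      _ = 2 * (Q * r Q ^ 2) := by
          rw [← Finset.mul_sum, sum_range_r]
          ring
      _ ≤ 1 := by linarith [r_sq_mul_le_one Q]
  have h2 : ∑ k ∈ Finset.Ico Q N, r (k + d) * r k ≤ G N - G Q := by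
    rw [G_sub hQ]
    refine Finset.sum_le_sum fun k _ => ?_
    rw [sq]
    exact mul_le_mul_of_nonneg_right (r_antitone (by omega)) (r_pos _).le
  linarith

theorem shiftR_inner_le {N Q : ℕ} (hQ : 1 ≤ Q) (hQN : Q ≤ N) (p p' : ℕ) :
    ∑ m ∈ Finset.range N, shiftR p m * shiftR p' m
      ≤ G N - (G Q - 1) * ((if p < Q + 1 then 1 else 0) * (if 2 * Q ≤ p' then 1 else 0)
        + (if 2 * Q ≤ p then 1 else 0) * (if p' < Q + 1 then 1 else 0)) := by
  wlog hle : p ≤ p' generalizing p p'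
  · have h := this p' p (by omega)
    simp only [mul_comm (shiftR p _)]
    refine h.trans (le_of_eq ?_)
    ring
  obtain ⟨d, rfl⟩ := Nat.exists_eq_add_of_le hle
  refine (sum_shiftR_mul_shiftR_le N p d).trans ?_
  by_cases h1 : p < Q + 1 ∧ 2 * Q ≤ p + d
  · refine (sum_r_add_mul_r_le hQN (d := d) (by omega)).trans (le_of_eq ?_)
    rw [if_pos h1.1, if_pos h1.2]
    by_cases h2 : 2 * Q ≤ p
    · rw [if_neg (by omega : ¬ p + d < Q + 1)]
      ring
    · rw [if_neg h2]
      ring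
  · refine (sum_r_add_mul_r_le_G N d).trans (le_of_eq ?_)
    by_cases h2 : 2 * Q ≤ p
    · rw [if_neg (by omega : ¬ p < Q + 1), if_neg (by omega : ¬ p + d < Q + 1)]
      ring
    · rw [if_neg h2]
      rcases not_and_or.mp h1 with h | h <;> rw [if_neg h] <;> ring

/-- Expands the square of a combination of the vectors `s p`, with `g` as a bound for all inner
products and a saving of `K` for the pairs selected by `χ` and `η`. -/
theorem sum_sq_sum_le {N : ℕ} {a χ η : ℕ → ℝ} {s : ℕ → ℕ → ℝ} {g K : ℝ} (ha : ∀ p, 0 ≤ a p)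
    (hs : ∀ p p', ∑ m ∈ Finset.range N, s p m * s p' m ≤ g - K * (χ p * η p' + η p * χ p')) :
    ∑ m ∈ Finset.range N, (∑ p ∈ Finset.range N, a p * s p m) ^ 2
      ≤ g * (∑ p ∈ Finset.range N, a p) ^ 2
        - 2 * K * (∑ p ∈ Finset.range N, a p * χ p) * ∑ p ∈ Finset.range N, a p * η p := by
  calc ∑ m ∈ Finset.range N, (∑ p ∈ Finset.range N, a p * s p m) ^ 2
      = ∑ p ∈ Finset.range N, ∑ p' ∈ Finset.range N,
          a p * a p' * ∑ m ∈ Finset.range N, s p m * s p' m := by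
        simp only [sq, Finset.sum_mul_sum]
        simp only [Finset.mul_sum]
        rw [Finset.sum_comm]
        refine Finset.sum_congr rfl fun p _ => ?_
        rw [Finset.sum_comm]
        refine Finset.sum_congr rfl fun p' _ => Finset.sum_congr rfl fun m _ => ?_
        ring
    _ ≤ ∑ p ∈ Finset.range N, ∑ p' ∈ Finset.range N,
          a p * a p' * (g - K * (χ p * η p' + η p * χ p')) := by
        refine Finset.sum_le_sum fun p _ => Finset.sum_le_sum fun p' _ => ?_
        exact mul_le_mul_of_nonneg_left (hs p p') (mul_nonneg (ha p) (ha p'))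
    _ = g * ((∑ p ∈ Finset.range N, a p) * ∑ p ∈ Finset.range N, a p)
        - K * ((∑ p ∈ Finset.range N, a p * χ p) * ∑ p ∈ Finset.range N, a p * η p)
        - K * ((∑ p ∈ Finset.range N, a p * η p) * ∑ p ∈ Finset.range N, a p * χ p) := by
        simp only [Finset.sum_mul_sum]
        simp only [Finset.mul_sum, ← Finset.sum_sub_distrib]
        refine Finset.sum_congr rfl fun p _ => Finset.sum_congr rfl fun p' _ => ?_
        ring
    _ = _ := by ring

/-- The bound for the rows near the bottom. Each row is a combination of shifts of `r` with
weights of total mass `√(G n)`; the shifts by at most `Q` and those by at least `2 Q` both carry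
mass, and they are far from parallel. -/
theorem sum_sq_leftEntry_le {n q N Q : ℕ} (hq : 1 ≤ q) (hqQ : q ≤ Q) (hQN : 2 * Q ≤ N)
    (hQn : 3 * Q ≤ n) (hn : q + N = n + 1) :
    ∑ m ∈ Finset.range N, leftEntry q m ^ 2
      ≤ G n ^ 2 - (G Q - 1) * G Q * (G n - G (3 * Q)) / G n := by
  have h := sum_sq_sum_le (N := N) (incr_nonneg q)
    (shiftR_inner_le (hq.trans hqQ) (by omega : Q ≤ N))
  rw [← Finset.sum_congr rfl fun m hm =>
    congrArg (· ^ 2) (leftEntry_eq_sum_shiftR q (Finset.mem_range.mp hm))] at h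
  have hS : ∑ p ∈ Finset.range N, incr q p = √(G n) := by
    obtain ⟨M, rfl⟩ : ∃ M, N = M + 1 := ⟨N - 1, by omega⟩
    rw [sum_range_incr]
    congr 2
    omega
  have hA : ∑ p ∈ Finset.range N, incr q p * (if p < Q + 1 then 1 else 0) = √(G (q + Q)) := by
    rw [← sum_range_incr, ← Finset.sum_range_add_sum_Ico _ (by omega : Q + 1 ≤ N),
      Finset.sum_eq_zero (s := Finset.Ico _ _), add_zero]
    · refine Finset.sum_congr rfl fun p hp => ?_
      rw [if_pos (Finset.mem_range.mp hp), mul_one]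
    · intro p hp
      rw [Finset.mem_Ico] at hp
      rw [if_neg (by omega), mul_zero]
  have hB : ∑ p ∈ Finset.range N, incr q p * (if 2 * Q ≤ p then 1 else 0)
      = √(G n) - √(G (q + (2 * Q - 1))) := by
    have e1 := Finset.sum_range_add_sum_Ico (incr q) hQN
    have e2 := sum_range_incr q (2 * Q - 1)
    rw [show 2 * Q - 1 + 1 = 2 * Q by omega] at e2
    rw [hS, e2] at e1
    rw [← Finset.sum_range_add_sum_Ico _ hQN, Finset.sum_eq_zero, zero_add, ← e1,
      add_sub_cancel_left]
    · refine Finset.sum_congr rfl fun p hp => ?_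
      rw [if_pos (Finset.mem_Ico.mp hp).1, mul_one]
    · intro p hp
      rw [Finset.mem_range] at hp
      rw [if_neg (by omega), mul_zero]
  rw [hS, hA, hB, Real.sq_sqrt (G_nonneg n)] at h
  refine h.trans ?_
  have hGQ := one_le_G (hq.trans hqQ)
  have hGn := one_le_G (by omega : 1 ≤ n)
  have hNn : G N ≤ G n := G_mono (by omega)
  have hGQn : G Q ≤ G n := G_mono (by omega)
  have h3Q : G (3 * Q) ≤ G n := G_mono hQn
  have hA' : √(G Q) ≤ √(G (q + Q)) := Real.sqrt_le_sqrt (G_mono (by omega))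
  have hB' : √(G n) - √(G (3 * Q)) ≤ √(G n) - √(G (q + (2 * Q - 1))) :=
    sub_le_sub_left (Real.sqrt_le_sqrt (G_mono (by omega))) _
  have hB0 : 0 ≤ √(G n) - √(G (3 * Q)) := sub_nonneg.mpr (Real.sqrt_le_sqrt h3Q)
  set x := √(G n) with hx
  set y := √(G (3 * Q)) with hy
  set z := √(G Q) with hz
  have hx2 : x ^ 2 = G n := Real.sq_sqrt (G_nonneg n)
  have hy2 : y ^ 2 = G (3 * Q) := Real.sq_sqrt (G_nonneg _)
  have hz2 : z ^ 2 = G Q := Real.sq_sqrt (G_nonneg _)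
  have hx0 : 0 < x := Real.sqrt_pos.mpr (by linarith)
  have hz0 : 0 ≤ z := Real.sqrt_nonneg _
  have hzx : z ≤ x := Real.sqrt_le_sqrt hGQn
  -- `x - y = (x² - y²) / (x + y)` with `x + y ≤ 2 x`, and `z / x ≥ (z / x)²`
  have key : G Q * (G n - G (3 * Q)) / G n ≤ 2 * z * (x - y) := by
    rw [← hx2, ← hy2, ← hz2, div_le_iff₀ (by positivity)]
    have e1 : z * (x + y) ≤ x * (2 * x) := by
      refine mul_le_mul hzx (by linarith) ?_ hx0.le
      exact add_nonneg hx0.le (Real.sqrt_nonneg _)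
    nlinarith [mul_le_mul_of_nonneg_left e1 (mul_nonneg hz0 hB0)]
  have key2 : z * (x - y) ≤ √(G (q + Q)) * (x - √(G (q + (2 * Q - 1)))) :=
    mul_le_mul hA' hB' hB0 (Real.sqrt_nonneg _)
  have key3 := mul_le_mul_of_nonneg_left key2 (by linarith : 0 ≤ 2 * (G Q - 1))
  have key4 := mul_le_mul_of_nonneg_left key (by linarith : 0 ≤ G Q - 1)
  have key5 : G N * G n ≤ G n ^ 2 := by nlinarith
  have e : (G Q - 1) * G Q * (G n - G (3 * Q)) / G n
      = (G Q - 1) * (G Q * (G n - G (3 * Q)) / G n) := by ring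
  rw [e]
  linarith

/-! ### Asymptotics -/

theorem tendsto_natDiv_div (s : ℕ) {k : ℕ} (hk : 0 < k) :
    Tendsto (fun n : ℕ => (((n + s) / k : ℕ) : ℝ) / n) atTop (𝓝 (1 / k)) := by
  have hk' : (0 : ℝ) < k := by exact_mod_cast hk
  have h0 := tendsto_const_div_atTop_nhds_zero_nat ((s : ℝ) / k + 1)
  refine tendsto_of_tendsto_of_dist (tendsto_const_nhds (x := (1 : ℝ) / k)) ?_
  refine squeeze_zero' (Eventually.of_forall fun _ => dist_nonneg) ?_ h0
  filter_upwards [eventually_gt_atTop 0] with n hn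
  have hn' : (0 : ℝ) < n := by exact_mod_cast hn
  have h1 : (((n + s) / k : ℕ) : ℝ) ≤ ((n : ℝ) + s) / k := by
    exact_mod_cast Nat.cast_div_le (α := ℝ) (m := n + s) (n := k)
  have h2 : ((n : ℝ) + s) / k < (((n + s) / k : ℕ) : ℝ) + 1 := by
    rw [div_lt_iff₀' hk']
    exact_mod_cast Nat.lt_mul_div_succ (n + s) hk
  rw [add_div] at h1 h2
  have h3 : (0 : ℝ) ≤ s / k := by positivity
  rw [Real.dist_eq, le_div_iff₀ hn', ← abs_of_pos hn', ← abs_mul, abs_of_pos hn']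
  have e : ((1 : ℝ) / k - (((n + s) / k : ℕ) : ℝ) / n) * n = n / k - (((n + s) / k : ℕ) : ℝ) := by
    field_simp
  rw [e, abs_le]
  constructor <;> linarith

/-- If `a n / n → c > 0`, then `G (a n) = (log n + log c) / π + alphaInf + o(1)`. -/
theorem tendsto_G_comp_sub_log {a : ℕ → ℕ} {c : ℝ} (hc : 0 < c)
    (ha : Tendsto (fun n => (a n : ℝ) / n) atTop (𝓝 c)) :
    Tendsto (fun n : ℕ => G (a n) - Real.log n / Real.pi) atTop
      (𝓝 (alphaInf + Real.log c / Real.pi)) := by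
  have h1 : Tendsto (fun n => (a n : ℝ)) atTop atTop := by
    refine (ha.pos_mul_atTop hc tendsto_natCast_atTop_atTop).congr' ?_
    filter_upwards [eventually_gt_atTop 0] with n hn
    have hn' : (n : ℝ) ≠ 0 := by exact_mod_cast hn.ne'
    field_simp
  have h2 := tendsto_alpha.comp (tendsto_natCast_atTop_iff.mp h1)
  have h3 := ((Real.continuousAt_log hc.ne').tendsto.comp ha).div_const Real.pi
  refine (h2.add h3).congr' ?_
  filter_upwards [eventually_gt_atTop 0, h1.eventually_gt_atTop 0] with n hn han
  have hn' : (n : ℝ) ≠ 0 := by exact_mod_cast hn.ne'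
  simp only [Function.comp_apply]
  rw [Real.log_div han.ne' hn', alpha, ← G]
  ring

theorem tendsto_G_natDiv (s : ℕ) {k : ℕ} (hk : 0 < k) :
    Tendsto (fun n : ℕ => G ((n + s) / k) - Real.log n / Real.pi) atTop
      (𝓝 (alphaInf - Real.log k / Real.pi)) := by
  have hk' : (0 : ℝ) < k := by exact_mod_cast hk
  have h := tendsto_G_comp_sub_log (by positivity) (tendsto_natDiv_div s hk)
  rwa [one_div, Real.log_inv, neg_div, ← sub_eq_add_neg] at h

/-- The estimate that makes the rows near the bottom harmless. With `Q = n / 32` the gain is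
asymptotically `log (32 / 3) / π · G n`, while only `2 log 2 / π · G n` is needed. -/
theorem eventually_bottom_le :
    ∀ᶠ n : ℕ in atTop, G n ^ 2
      - (G (n / 32) - 1) * G (n / 32) * (G n - G (3 * (n / 32))) / G n ≤ G ((n + 2) / 2) ^ 2 := by
  have hn := tendsto_G_natDiv 0 one_pos
  have hT := tendsto_G_natDiv 2 two_pos
  have hQ := tendsto_G_natDiv 0 (k := 32) (by norm_num)
  have h3 : Tendsto (fun n : ℕ => G (3 * (n / 32)) - Real.log n / Real.pi) atTop
      (𝓝 (alphaInf + Real.log (3 / 32) / Real.pi)) := by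
    refine tendsto_G_comp_sub_log (by norm_num) ?_
    have h := (tendsto_natDiv_div 0 (k := 32) (by norm_num)).const_mul 3
    have e : (3 : ℝ) * (1 / (32 : ℕ)) = 3 / 32 := by norm_num
    rw [e] at h
    refine h.congr fun n => ?_
    push_cast
    rw [add_zero]
    ring
  simp only [add_zero, Nat.div_one, Nat.cast_one, Real.log_one, zero_div, sub_zero] at hn hQ
  have hinv : Tendsto (fun n : ℕ => (G n)⁻¹) atTop (𝓝 0) := tendsto_G_atTop.inv_tendsto_atTop
  have hlam : Tendsto (fun n : ℕ => 2 * (G n - G ((n + 2) / 2))) atTop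
      (𝓝 (2 * (Real.log 2 / Real.pi))) := by
    have h := (hn.sub hT).const_mul 2
    simp only [sub_sub_sub_cancel_right, sub_sub_cancel] at h
    exact_mod_cast h
  have hbeta : Tendsto (fun n : ℕ => G n - G (3 * (n / 32))) atTop
      (𝓝 (-(Real.log (3 / 32) / Real.pi))) := by
    have h := hn.sub h3
    simp only [sub_sub_sub_cancel_right, sub_add_cancel_left] at h
    exact h
  have hratio : ∀ d : ℝ, Tendsto (fun n : ℕ => (G (n / 32) - d) / G n) atTop (𝓝 1) := by
    intro d
    have h := (((hn.sub hQ).add_const d).mul hinv).const_sub 1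
    rw [mul_zero, sub_zero] at h
    refine h.congr' ?_
    filter_upwards [eventually_ge_atTop 1] with n hn1
    have := one_le_G hn1
    field_simp
    ring
  have hgain := ((hratio 1).mul (hratio 0)).mul hbeta
  have hlt : 2 * (Real.log 2 / Real.pi) < 1 * 1 * -(Real.log (3 / 32) / Real.pi) := by
    have hp := Real.pi_pos
    have h : 2 * Real.log 2 < -Real.log (3 / 32) := by
      rw [← Real.log_inv, ← Nat.cast_ofNat (R := ℝ) (n := 2), ← Real.log_pow]
      exact Real.log_lt_log (by norm_num) (by norm_num)
    rw [one_mul, one_mul, ← neg_div, ← mul_div_assoc]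
    exact div_lt_div_of_pos_right h hp
  -- with `x = G n` and `t = G ((n + 2) / 2)`, `x² - t² ≤ 2 (x - t) x`
  filter_upwards [hlam.eventually_lt hgain hlt, eventually_ge_atTop 1] with n h hn1
  have hG := one_le_G hn1
  have h2 := mul_le_mul_of_nonneg_right h.le (by linarith : 0 ≤ G n)
  have e : (G (n / 32) - 1) / G n * ((G (n / 32) - 0) / G n) * (G n - G (3 * (n / 32))) * G n
      = (G (n / 32) - 1) * G (n / 32) * (G n - G (3 * (n / 32))) / G n := by
    field_simp
    ring
  rw [e] at h2
  nlinarith [sq_nonneg (G n - G ((n + 2) / 2))]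

theorem rowNorm_eq_sqrt {n : ℕ} {C : Matrix (Fin n) (Fin n) ℝ} (hC : C * C = Mcount n)
    (i : Fin n) : rowNorm (nsrLeft C) i
      = √(∑ m ∈ Finset.range (i + 1), leftEntry (n - i) m ^ 2) := by
  rw [← sq_rowNorm_nsrLeft hC, Real.sqrt_sq (rowNorm_nonneg _ _)]

/-- The lower bound comes from the middle row. -/
theorem G_half_le_maxSE {n : ℕ} (hn : 1 ≤ n) {C : Matrix (Fin n) (Fin n) ℝ}
    (hC : C * C = Mcount n) : G (n / 2) ≤ maxSE (nsrLeft C) (nsrRight C) := by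
  rw [maxSE_nsr hn hC]
  let i : Fin n := ⟨n / 2, by omega⟩
  refine le_trans ?_ (le_ciSup (Set.finite_range _).bddAbove i)
  rw [rowNorm_eq_sqrt hC]
  refine Real.le_sqrt_of_sq_le (le_trans ?_ (G_mul_G_le_sum_sq_leftEntry _ _))
  rw [sq]
  exact mul_le_mul (G_mono (by simp only [i]; omega)) (G_mono (by simp only [i]; omega))
    (G_nonneg _) (G_nonneg _)

/-- The upper bound; the last term is the contribution of all increments but the first in the rows
away from the bottom. -/
theorem eventually_maxSE_le :
    ∀ᶠ n : ℕ in atTop, ∀ C : Matrix (Fin n) (Fin n) ℝ, C * C = Mcount n →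
      maxSE (nsrLeft C) (nsrRight C) ≤ G ((n + 2) / 2) + 32 / √(G (n / 32)) := by
  filter_upwards [eventually_bottom_le, eventually_ge_atTop 32] with n hbot hn C hC
  have : Nonempty (Fin n) := ⟨⟨0, by omega⟩⟩
  have hGQ : 0 < √(G (n / 32)) := Real.sqrt_pos.mpr (one_pos.trans_le (one_le_G (by omega)))
  rw [maxSE_nsr (by omega) hC]
  refine ciSup_le fun i => ?_
  rw [rowNorm_eq_sqrt hC]
  have hi := i.2
  rcases le_or_gt (n - i : ℕ) (n / 32) with hq | hq
  · have h := sum_sq_leftEntry_le (n := n) (q := n - i) (N := i + 1) (Q := n / 32)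
      (by omega) hq (by omega) (by omega) (by omega)
    have h2 := Real.sqrt_le_sqrt (h.trans hbot)
    rw [Real.sqrt_sq (G_nonneg _)] at h2
    have : 0 ≤ 32 / √(G (n / 32)) := by positivity
    linarith
  · refine (sqrt_sum_sq_leftEntry_le (by omega) _).trans (add_le_add ?_ ?_)
    · have := G_add_G_le (a := n - i) (b := i + 1) (h := (n + 2) / 2) (by omega)
      linarith
    · have h1 : ((i + 1 : ℕ) : ℝ) ≤ 32 * ((n - i : ℕ) : ℝ) := by
        exact_mod_cast (by omega : (i : ℕ) + 1 ≤ 32 * (n - i))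
      have h2 : √(G (n / 32)) ≤ √(G (n - i)) := Real.sqrt_le_sqrt (G_mono hq.le)
      have h3 : (0 : ℝ) < ((n - i : ℕ) : ℝ) := by exact_mod_cast (by omega : 0 < n - (i : ℕ))
      have h4 := hGQ.trans_le h2
      rw [div_le_div_iff₀ (by positivity) hGQ]
      calc ((i + 1 : ℕ) : ℝ) * √(G (n / 32)) ≤ 32 * ((n - i : ℕ) : ℝ) * √(G (n - i)) := by gcongr
        _ = _ := by ring

end NSR

end

theorem mainTheorem2
    (C : (n : ℕ) → Matrix (Fin n) (Fin n) ℝ) (hC : ∀ n, C n * C n = NSR.Mcount n) :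
    ∃ αinf : ℝ, Tendsto NSR.alpha atTop (𝓝 αinf) ∧
      (fun n : ℕ => NSR.maxSE (NSR.nsrLeft (C n)) (NSR.nsrRight (C n))
          - (αinf - Real.log 2 / Real.pi + Real.log n / Real.pi)) =o[atTop] (fun _ => (1 : ℝ)) ∧
      ∃ ε : ℕ → ℝ, ε =o[atTop] (fun _ => (1 : ℝ)) ∧
        ∀ n : ℕ, 1 ≤ n →
          NSR.maxSE (NSR.nsrLeft (C n)) (NSR.nsrRight (C n))
            ≤ 0.846 + Real.log n / Real.pi + ε n := by
  have hmain : (fun n : ℕ => NSR.maxSE (NSR.nsrLeft (C n)) (NSR.nsrRight (C n))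
      - (NSR.alphaInf - Real.log 2 / Real.pi + Real.log n / Real.pi))
      =o[atTop] (fun _ => (1 : ℝ)) := by
    rw [isLittleO_one_iff]
    have hlow := (NSR.tendsto_G_natDiv 0 two_pos).sub_const
      (NSR.alphaInf - Real.log 2 / Real.pi)
    have hupp := (NSR.tendsto_G_natDiv 2 two_pos).sub_const
      (NSR.alphaInf - Real.log 2 / Real.pi)
    rw [Nat.cast_ofNat, sub_self] at hlow hupp
    have herr : Tendsto (fun n : ℕ => 32 / √(NSR.G (n / 32))) atTop (𝓝 0) :=
      tendsto_const_nhds.div_atTop (Real.tendsto_sqrt_atTop.comp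
        (NSR.tendsto_G_atTop.comp (Nat.tendsto_div_const_atTop (by norm_num))))
    have hupp' := hupp.add herr
    rw [add_zero] at hupp'
    refine tendsto_of_tendsto_of_tendsto_of_le_of_le' hlow hupp' ?_ ?_
    · filter_upwards [eventually_ge_atTop 1] with n hn
      have := NSR.G_half_le_maxSE hn (hC n)
      simp only [add_zero]
      linarith
    · filter_upwards [NSR.eventually_maxSE_le] with n hn
      have := hn (C n) (hC n)
      linarith
  refine ⟨NSR.alphaInf, NSR.tendsto_alpha, hmain, _, hmain, fun n _ => ?_⟩
  have := NSR.alphaInf_le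
  linarith
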